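/- Let $G$ be a locally compact second countable Hausdorff group with identity $e$, let $X$ be a standard Borel space on which $G$ acts transitively by a Borel map $G\times X\to X$, $(g,x)\mapsto g\cdot x$ (for instance $X=G/G_0$ with $G_0\subset G$ a closed subgroup), and let $M$ be a standard Borel group with identity $\mathbf 1$. Let $\mathbf T$ be the group of complex numbers of modulus $1$, acting on $M$ by multiplication by central elements through a Borel homomorphism from $\mathbf T$ to the center of $M$ (for instance the scalars in $M=\mathcal U(\mathcal H)$, $\mathcal H$ a separable Hilbert space). Let $m:G\times G\to\mathbf T$ be a multiplier of $G$, i.e. a Borel map with $m(g,e)=m(e,g)=1$ and $m(g_1g_2,g_3)\,m(g_1,g_2)=m(g_1,g_2g_3)\,m(g_2,g_3)$ for all $g,g_1,g_2,g_3\in G$. "Almost all" refers to Haar measure on $G$, to the $G$-invariant measure class on $X$ (the class of any nonzero $\sigma$-finite $G$-quasi-invariant measure), and to the corresponding product classes on $G\times X$ and $G\times G\times X$. An $m$-$(G,X,M)$-cocycle is a Borel map $f:G\times X\to M$ such that $f(e,x)=\mathbf 1$ for almost all $x\in X$ and $$f(g_1g_2,x)=m(g_1,g_2)\,f(g_1,g_2\cdot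 x)\,f(g_2,x)$$ for almost all $(g_1,g_2,x)\in G\times G\times X$; it is strict if both identities hold everywhere. Strict cocycles $f_1,f_2$ are strictly cohomologous if there is a Borel map $b:X\to M$ with $f_2(g,x)=b(g\cdot x)\,f_1(g,x)\,b(x)^{-1}$ for all $(g,x)\in G\times X$. Let $f$ be any $m$-$(G,X,M)$-cocycle. Then there exists a strict $m$-$(G,X,M)$-cocycle $f_1$ such that $f(g,x)=f_1(g,x)$ for almost all $(g,x)\in G\times X$. Moreover $f_1$ is unique up to strict cohomology: any two strict $m$-$(G,X,M)$-cocycles that agree with $f$ almost everywhere on $G\times X$ are strictly cohomologous. -/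

import Mathlib

open MeasureTheory

noncomputable instance instMeasurableSpaceCircleBorel : MeasurableSpace Circle := borel Circle

instance instBorelSpaceCircleBorel : BorelSpace Circle := ⟨rfl⟩

/-- A multiplier of the group `G`: a Borel map `m : G × G → 𝕋`, normalized at the identity and
satisfying the multiplier identity. -/
structure IsMultiplier {G : Type*} [Group G] [MeasurableSpace G] (m : G → G → Circle) : Prop where
  measurable : Measurable (fun p : G × G => m p.1 p.2)
  one_left : ∀ g : G, m 1 g = 1
  one_right : ∀ g : G, m g 1 = 1
  assoc : ∀ g₁ g₂ g₃ : G, m (g₁ * g₂) g₃ * m g₁ g₂ = m g₁ (g₂ * g₃) * m g₂ g₃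

/-- The measure class of `α` is invariant under `G`: every `g : G` maps `α`-null sets to
`α`-null sets. Applied to `g⁻¹` as well, this says that all translates of `α` are mutually
absolutely continuous with `α`. -/
def IsQuasiInvariant (G : Type*) {X : Type*} [Group G] [MulAction G X] [MeasurableSpace X]
    (α : Measure X) : Prop :=
  ∀ g : G, Measure.QuasiMeasurePreserving (fun x : X => g • x) α α

/-- An `m`-`(G, X, M)`-cocycle relative to the measure class of `α` on `X` (and the class of `μ`,
a Haar measure, on `G`). The homomorphism `ι : 𝕋 → M` is the one through which scalars of
modulus `1` multiply elements of `M`. -/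
structure IsCocycle {G X M : Type*} [Group G] [MeasurableSpace G] [MeasurableSpace X]
    [MulAction G X] [Group M] [MeasurableSpace M] (ι : Circle →* M) (m : G → G → Circle)
    (μ : Measure G) (α : Measure X) (f : G × X → M) : Prop where
  measurable : Measurable f
  map_one : ∀ᵐ x ∂α, f (1, x) = 1
  map_mul : ∀ᵐ p : G × G × X ∂(μ.prod (μ.prod α)),
    f (p.1 * p.2.1, p.2.2) = ι (m p.1 p.2.1) * f (p.1, p.2.1 • p.2.2) * f (p.2.1, p.2.2)

/-- A strict `m`-`(G, X, M)`-cocycle: the identities hold everywhere. -/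
structure IsStrictCocycle {G X M : Type*} [Group G] [MeasurableSpace G] [MeasurableSpace X]
    [MulAction G X] [Group M] [MeasurableSpace M] (ι : Circle →* M) (m : G → G → Circle)
    (f : G × X → M) : Prop where
  measurable : Measurable f
  map_one : ∀ x : X, f (1, x) = 1
  map_mul : ∀ (g₁ g₂ : G) (x : X),
    f (g₁ * g₂, x) = ι (m g₁ g₂) * f (g₁, g₂ • x) * f (g₂, x)

/-- Strict cohomology of (strict) cocycles. -/
def StrictlyCohomologous {G X M : Type*} [MeasurableSpace X] [SMul G X] [Group M]
    [MeasurableSpace M] (f₁ f₂ : G × X → M) : Prop :=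
  ∃ b : X → M, Measurable b ∧ ∀ (g : G) (x : X), f₂ (g, x) = b (g • x) * f₁ (g, x) * (b x)⁻¹

open Filter Topology Set
open scoped Pointwise

/-! Pull `f` back along the orbit map of `x₀` to `F g k = f (g, k • x₀)`. On `G × G` every cocycle
is a coboundary up to null sets: freezing the third variable at a generic point gives `b` with `F g
k = m(g,k)⁻¹ b(gk) b(k)⁻¹` a.e. (`exists_ae_eq_coboundary`). Since `F` is right invariant under the
stabilizer `H`, the quantity `m(k,h)⁻¹ b(k)⁻¹ b(kh)` is left invariant in `k` up to null sets, hence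
a.e. a constant `φ h`, and `φ` is an exact projective homomorphism on `H`. A Borel section `c` of
the orbit map then lets `b` be rebuilt off a null set so that `b(kh) = m(k,h) b(k) φ(h)` everywhere
(`exists_equivariant_ae_eq`); the coboundary of such a `b` descends to a strict cocycle on `X`. For
uniqueness, `f₂(k,x₀)⁻¹ f₁(k,x₀)` is a.e. a constant, which intertwines the two restrictions to `H`.
-/

/-- A locally compact second countable Hausdorff group is Polish. -/
theorem polishSpace_of_locallyCompact_group (G : Type*) [Group G] [TopologicalSpace G]
    [IsTopologicalGroup G] [LocallyCompactSpace G] [SecondCountableTopology G] [T2Space G] :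
    PolishSpace G := by
  let _ := IsTopologicalGroup.rightUniformSpace G
  have : IsRightUniformGroup G := { uniformity_eq := rfl }
  have : CompleteSpace G := IsRightUniformGroup.completeSpace_of_weaklyLocallyCompactSpace
  have : (uniformity G).IsCountablyGenerated := by
    rw [uniformity_eq_comap_nhds_one]
    infer_instance
  exact { }

/-! ### Closed stabilizers -/

/-- In a locally compact group, the set of quotients of two sets of positive Haar measure meets
every dense set. -/
theorem Dense.exists_mem_div_of_haar_pos {G : Type*} [Group G] [TopologicalSpace G]
    [IsTopologicalGroup G] [LocallyCompactSpace G] [SecondCountableTopology G] [T2Space G]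
    [MeasurableSpace G] [BorelSpace G] {μ : Measure G} [μ.IsHaarMeasure] [μ.InnerRegular]
    {D A B : Set G} (hD : Dense D) (hA : MeasurableSet A) (hB : MeasurableSet B)
    (hA₀ : μ A ≠ 0) (hB₀ : μ B ≠ 0) : ∃ a ∈ A, ∃ b ∈ B, a * b⁻¹ ∈ D := by
  -- Fubini: otherwise some `x ∈ A` has `g⁻¹ * x ∉ B` for almost all `g`, and `g = x / b` makes `B`
  -- null.
  obtain ⟨g, hg⟩ : ∃ g : G, μ (A ∩ (fun x => g⁻¹ * x) ⁻¹' B) ≠ 0 := by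
    by_contra! h
    have hmeas : MeasurableSet {p : G × G | ¬ (p.2 ∈ A ∧ p.1⁻¹ * p.2 ∈ B)} := by
      refine MeasurableSet.compl (MeasurableSet.inter (measurable_snd hA) ?_)
      exact (measurable_fst.inv.mul measurable_snd) hB
    have h₁ : ∀ᵐ g ∂μ, ∀ᵐ x ∂μ, ¬ (x ∈ A ∧ g⁻¹ * x ∈ B) := by
      refine .of_forall fun g => ?_
      rw [ae_iff]
      simpa only [not_not] using! h g
    rw [Measure.ae_ae_comm (p := fun g x => ¬ (x ∈ A ∧ g⁻¹ * x ∈ B)) hmeas] at h₁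
    have h₂ : ∃ᵐ x ∂μ, x ∈ A := by
      rw [frequently_ae_iff]
      exact hA₀
    obtain ⟨x, hxA, hx⟩ := (h₂.and_eventually h₁).exists
    have h₃ := (quasiMeasurePreserving_div_left μ x).ae hx
    refine hB₀ (measure_eq_zero_iff_ae_notMem.2 ?_)
    filter_upwards [h₃] with b hb hbB
    exact hb ⟨hxA, by simpa using hbB⟩
  have hC : MeasurableSet (A ∩ (fun x => g⁻¹ * x) ⁻¹' B) :=
    hA.inter (measurable_const_mul _ hB)
  -- Steinhaus for `C = A ∩ gB`: the neighbourhood `(C / C) * g` of `g` meets `D`.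
  have hN := Measure.div_mem_nhds_one_of_haar_pos μ _ hC (pos_iff_ne_zero.2 hg)
  have hN' : (fun d => d * g⁻¹) ⁻¹' ((A ∩ (fun x => g⁻¹ * x) ⁻¹' B) /
      (A ∩ (fun x => g⁻¹ * x) ⁻¹' B)) ∈ 𝓝 g := by
    refine (continuous_mul_const g⁻¹).continuousAt.preimage_mem_nhds ?_
    simpa using hN
  obtain ⟨d, hd, hdD⟩ := hD.inter_nhds_nonempty hN'
  obtain ⟨a, ⟨haA, -⟩, b, ⟨-, hbB⟩, hab⟩ := hdD
  refine ⟨a, haA, g⁻¹ * b, hbB, ?_⟩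
  have : a * (g⁻¹ * b)⁻¹ = d := by
    rw [mul_inv_rev, inv_inv, ← mul_assoc, ← div_eq_mul_inv]
    exact mul_inv_eq_iff_eq_mul.1 hab.symm |>.symm ▸ rfl
  rwa [this]

/-- Stabilizers of Borel actions of locally compact second countable groups are closed. -/
theorem isClosed_stabilizer_of_measurable {G X : Type*} [Group G] [TopologicalSpace G]
    [IsTopologicalGroup G] [LocallyCompactSpace G] [SecondCountableTopology G] [T2Space G]
    [MeasurableSpace G] [BorelSpace G] [MeasurableSpace X] [StandardBorelSpace X]
    [MulAction G X] [MeasurableSMul₂ G X] (x₀ : X) :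
    IsClosed (MulAction.stabilizer G x₀ : Set G) := by
  set H := MulAction.stabilizer G x₀
  set L := H.topologicalClosure
  have hLc : IsClosed (L : Set G) := H.isClosed_topologicalClosure
  have : LocallyCompactSpace L := hLc.isClosedEmbedding_subtypeVal.locallyCompactSpace
  set D : Subgroup L := H.subgroupOf L
  have hD : Dense (D : Set L) := by
    rw [IsInducing.subtypeVal.dense_iff]
    rintro ⟨x, hx⟩
    have : Subtype.val '' (D : Set L) = (H : Set G) := by
      ext g
      simp only [mem_image, SetLike.mem_coe, Subtype.exists, exists_and_right, exists_eq_right, D,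
        Subgroup.mem_subgroupOf]
      exact ⟨fun h => h.2, fun h => ⟨H.le_topologicalClosure h, h⟩⟩
    exact this.symm ▸ hx
  let μ : Measure L := Measure.haar
  have : SecondCountableTopology L := TopologicalSpace.Subtype.secondCountableTopology (L : Set G)
  have : μ.InnerRegular := inferInstanceAs (Measure.haar : Measure L).InnerRegular
  have hf : Measurable fun l : L => (l : G)⁻¹ • x₀ := by fun_prop
  -- Ergodicity of the dense subgroup: this map is invariant under left translation by `H`, so no
  -- Borel set can split `L` into two non-null preimages.
  obtain ⟨y, hy⟩ : ∃ y, (fun l : L => (l : G)⁻¹ • x₀) =ᵐ[μ] fun _ => y := by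
    have : Nonempty X := ⟨x₀⟩
    refine exists_eventuallyEq_const_of_forall_separating MeasurableSet fun U hU => ?_
    by_contra! hcon
    obtain ⟨a, ha, b, hb, hab⟩ := hD.exists_mem_div_of_haar_pos (μ := μ) (hf hU) (hf hU.compl)
      (frequently_ae_iff.1 (by simpa using hcon.2)) (frequently_ae_iff.1 (by simpa using hcon.1))
    refine hb ?_
    have hab' : ((a : G) * (b : G)⁻¹) • x₀ = x₀ := hab
    have hba : (b : G)⁻¹ • x₀ = (a : G)⁻¹ • x₀ := by
      rw [eq_inv_smul_iff, ← mul_smul, hab']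
    change (b : G)⁻¹ • x₀ ∈ U
    rwa [hba]
  have hC : MeasurableSet ((fun l : L => (l : G)⁻¹ • x₀) ⁻¹' {y}) := hf (measurableSet_singleton y)
  have hN := Measure.div_mem_nhds_one_of_haar_pos μ _ hC (by
    refine pos_iff_ne_zero.2 (frequently_ae_iff.1 (Eventually.frequently hy)))
  -- The conull fibre `C` satisfies `C / C ⊆ D`, so Steinhaus makes `D` open, hence closed, hence
  -- all of `L`.
  have hDo : IsOpen (D : Set L) := by
    refine Subgroup.isOpen_of_mem_nhds D (g := 1) (mem_of_superset hN ?_)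
    rintro _ ⟨a, ha, b, hb, rfl⟩
    have ha' : (a : G)⁻¹ • x₀ = y := ha
    have hb' : (b : G)⁻¹ • x₀ = y := hb
    change ((a : G) / (b : G)) • x₀ = x₀
    rw [div_eq_mul_inv, mul_smul, hb', ← ha', smul_inv_smul]
  have hDu : (D : Set L) = univ := by
    rw [← (D.isClosed_of_isOpen hDo).closure_eq, hD.closure_eq]
  have hLH : L ≤ H := fun g hg => by
    have : (⟨g, hg⟩ : L) ∈ (D : Set L) := by rw [hDu]; trivial
    exact Subgroup.mem_subgroupOf.1 this
  rwa [le_antisymm hLH H.le_topologicalClosure] at hLc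

/-! ### Borel sections -/

/-- Measurable selection: a map with closed fibres from a Polish space for which the images of open
sets are measurable has a measurable section. -/
theorem exists_measurable_section_of_isClosed_fiber {G X : Type*} [TopologicalSpace G]
    [PolishSpace G] [MeasurableSpace G] [BorelSpace G] [MeasurableSpace X] {p : G → X}
    (hp : Function.Surjective p) (hc : ∀ x, IsClosed (p ⁻¹' {x}))
    (ho : ∀ U, IsOpen U → MeasurableSet (p '' U)) :
    ∃ c : X → G, Measurable c ∧ ∀ x, p (c x) = x := by
  rcases isEmpty_or_nonempty X with hX | hX
  · exact ⟨fun x => hX.elim x, measurable_of_empty _, fun x => hX.elim x⟩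
  have : Nonempty G := ⟨(hp hX.some).choose⟩
  let _ := TopologicalSpace.upgradeIsCompletelyMetrizable G
  let d := TopologicalSpace.denseSeq G
  let r : ℕ → ℝ := fun n => (1 / 2) ^ n
  have hr : ∀ n, 0 < r n := fun n => by positivity
  -- At stage `n`, `k x` indexes a ball of radius `2⁻ⁿ` that meets the fibre over `x`; the centres
  -- converge to a point of the closed fibre.
  let P : ℕ → (X → ℕ) → Prop := fun n k => Measurable k ∧ ∀ x, x ∈ p '' Metric.ball (d (k x)) (r n)
  have step : ∀ n (V : ℕ → Set G), (∀ i, IsOpen (V i)) → ∀ k : X → ℕ, Measurable k →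
      (∀ x, x ∈ p '' V (k x)) → ∃ k' : X → ℕ, Measurable k' ∧
        ∀ x, x ∈ p '' (V (k x) ∩ Metric.ball (d (k' x)) (r n)) := by
    intro n V hV k hk hkV
    have hex : ∀ x, ∃ j, x ∈ p '' (V (k x) ∩ Metric.ball (d j) (r n)) := fun x => by
      obtain ⟨y, hy, hyx⟩ := hkV x
      obtain ⟨j, hj⟩ := (TopologicalSpace.denseRange_denseSeq G).exists_dist_lt y (hr n)
      exact ⟨j, y, ⟨hy, hj⟩, hyx⟩
    classical
    refine ⟨fun x => Nat.find (hex x), measurable_find hex fun j => ?_,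
      fun x => Nat.find_spec (hex x)⟩
    have : {x | x ∈ p '' (V (k x) ∩ Metric.ball (d j) (r n))} =
        ⋃ i, k ⁻¹' {i} ∩ p '' (V i ∩ Metric.ball (d j) (r n)) := by
      ext x
      simp
    rw [this]
    exact .iUnion fun i => (hk (measurableSet_singleton i)).inter
      (ho _ ((hV i).inter Metric.isOpen_ball))
  obtain ⟨k₀, hk₀, hk₀'⟩ := step 0 (fun _ => univ) (fun _ => isOpen_univ) (fun _ => 0)
    measurable_const fun x => by simpa using hp x
  have step' : ∀ n (k : {k : X → ℕ // P n k}), ∃ k' : {k : X → ℕ // P (n + 1) k},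
      ∀ x, dist (d (k.1 x)) (d (k'.1 x)) ≤ 2 * (1 / 2) ^ n := by
    rintro n ⟨k, hk, hkP⟩
    obtain ⟨k', hk', hkk'⟩ := step (n + 1) (fun i => Metric.ball (d i) (r n))
      (fun i => Metric.isOpen_ball) k hk hkP
    refine ⟨⟨k', hk', fun x => image_mono inter_subset_right (hkk' x)⟩, fun x => ?_⟩
    obtain ⟨y, ⟨hy₁, hy₂⟩, -⟩ := hkk' x
    rw [Metric.mem_ball] at hy₁ hy₂
    have h₁ := dist_triangle_left (d (k x)) (d (k' x)) y
    have h₂ : r (n + 1) ≤ r n := by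
      simp only [r, pow_succ]
      have := hr n
      simp only [r] at this
      linarith
    change _ ≤ 2 * r n
    dsimp only
    linarith
  choose next hnext using step'
  let k : (n : ℕ) → {k : X → ℕ // P n k} := fun n =>
    Nat.rec ⟨k₀, hk₀, fun x => by simpa using hk₀' x⟩ (fun n k => next n k) n
  have hcau : ∀ x, CauchySeq fun n => d ((k n).1 x) := fun x =>
    cauchySeq_of_le_geometric (1 / 2) 2 (by norm_num) fun n => hnext n (k n) x
  choose c hcl using fun x => cauchySeq_tendsto_of_complete (hcau x)
  refine ⟨c, ?_, fun x => ?_⟩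
  · refine measurable_of_tendsto_metrizable (f := fun n x => d ((k n).1 x)) (fun n => ?_)
      (tendsto_pi_nhds.2 hcl)
    exact (measurable_from_nat (f := d)).comp (k n).2.1
  · choose y hy hyx using fun n => (k n).2.2 x
    have hr0 : Tendsto r atTop (𝓝 0) :=
      tendsto_pow_atTop_nhds_zero_of_lt_one (by norm_num) (by norm_num)
    have hyc : Tendsto y atTop (𝓝 (c x)) := by
      refine (hcl x).congr_dist ?_
      refine squeeze_zero (fun _ => dist_nonneg) (fun n => ?_) hr0
      rw [dist_comm]
      exact (Metric.mem_ball.1 (hy n)).le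
    exact (hc x).mem_of_tendsto hyc (.of_forall hyx)

/-- A transitive standard Borel space of a locally compact second countable group has a Borel
section. -/
theorem exists_measurable_section_of_isPretransitive {G X : Type*} [Group G] [TopologicalSpace G]
    [IsTopologicalGroup G] [LocallyCompactSpace G] [SecondCountableTopology G] [T2Space G]
    [MeasurableSpace G] [BorelSpace G] [MeasurableSpace X] [StandardBorelSpace X]
    [MulAction G X] [MeasurableSMul₂ G X] [MulAction.IsPretransitive G X] (x₀ : X) :
    ∃ c : X → G, Measurable c ∧ ∀ x, c x • x₀ = x := by
  have := polishSpace_of_locallyCompact_group G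
  have hp : Measurable fun g : G => g • x₀ := by fun_prop
  have hs : Function.Surjective fun g : G => g • x₀ := MulAction.surjective_smul G x₀
  refine exists_measurable_section_of_isClosed_fiber hs (fun x => ?_) fun U hU => ?_
  · obtain ⟨g, rfl⟩ := hs x
    have : (fun g : G => g • x₀) ⁻¹' {g • x₀} =
        (fun k => g⁻¹ * k) ⁻¹' (MulAction.stabilizer G x₀ : Set G) := by
      ext k
      simp [mul_smul, inv_smul_eq_iff]
    dsimp only
    rw [this]
    exact (isClosed_stabilizer_of_measurable x₀).preimage (continuous_const_mul g⁻¹)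
  -- The image is Borel as soon as its preimage is, and that preimage, the saturation of `U` under
  -- the stabilizer, is open.
  · rw [← hp.measurableSet_preimage_iff_of_surjective hs]
    have : (fun g : G => g • x₀) ⁻¹' ((fun g : G => g • x₀) '' U) =
        ⋃ h ∈ MulAction.stabilizer G x₀, (fun k => k * h) ⁻¹' U := by
      ext k
      simp only [mem_preimage, mem_image, mem_iUnion, exists_prop, MulAction.mem_stabilizer_iff]
      constructor
      · rintro ⟨u, hu, huk⟩
        exact ⟨k⁻¹ * u, by rw [mul_smul, huk, inv_smul_smul], by simpa using hu⟩
      · rintro ⟨h, hh, hu⟩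
        exact ⟨k * h, hu, by rw [mul_smul, hh]⟩
    rw [this]
    exact (isOpen_biUnion fun h _ => hU.preimage (continuous_mul_const h)).measurableSet

/-! ### Almost invariant functions and null sets -/

/-- A function invariant under almost all left translations is almost everywhere constant. -/
theorem exists_ae_eq_const_of_ae_mul_left_eq {G M : Type*} [Group G] [MeasurableSpace G]
    [MeasurableMul₂ G] [MeasurableInv G] {μ : Measure G} [SFinite μ] [μ.IsMulLeftInvariant]
    [NeZero μ] {u : G → M} (hu : ∀ᵐ p : G × G ∂(μ.prod μ), u (p.1 * p.2) = u p.2) :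
    ∃ a, ∀ᵐ g ∂μ, u g = a := by
  have h := Measure.ae_ae_of_ae_prod
    (Measure.measurePreserving_swap.quasiMeasurePreserving.ae hu)
  obtain ⟨k, hk⟩ := h.exists
  refine ⟨u k, ?_⟩
  filter_upwards [(quasiMeasurePreserving_mul_right μ k⁻¹).ae hk] with g hg
  simpa using hg

/-- The almost everywhere constant values of a family of functions can be chosen measurably. -/
theorem exists_measurable_ae_const_value {Y G M : Type*} [MeasurableSpace Y] [MeasurableSpace G]
    [MeasurableSpace M] [StandardBorelSpace M] [Nonempty M] (μ : Measure G) [SFinite μ] [NeZero μ]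
    {u : Y → G → M} (hu : Measurable fun p : Y × G => u p.1 p.2) :
    ∃ v : Y → M, Measurable v ∧ ∀ y a, (∀ᵐ g ∂μ, u y g = a) → v y = a := by
  have he := measurableEmbedding_embeddingReal M
  -- `μ.toFinite` is a probability measure with the same null sets, so an a.e. constant integrates
  -- to its value.
  have hm : StronglyMeasurable fun y => ∫ g, embeddingReal M (u y g) ∂μ.toFinite :=
    StronglyMeasurable.integral_prod_right
      (f := fun y g => embeddingReal M (u y g)) (he.measurable.comp hu).stronglyMeasurable
  refine ⟨fun y => he.invFun (∫ g, embeddingReal M (u y g) ∂μ.toFinite),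
    he.measurable_invFun.comp hm.measurable, fun y a hya => ?_⟩
  have : ∫ g, embeddingReal M (u y g) ∂μ.toFinite = embeddingReal M a := by
    have hya' : ∀ᵐ g ∂μ.toFinite, embeddingReal M (u y g) = embeddingReal M a := by
      rw [ae_toFinite]
      filter_upwards [hya] with g hg
      rw [hg]
    rw [integral_congr_ae hya']
    simp
  dsimp only
  rw [this, he.leftInverse_invFun]

section MeasureClass

variable {G X : Type*} [Group G] [MeasurableSpace G] [MeasurableMul₂ G] [MeasurableInv G]
  [MeasurableSpace X] [MulAction G X] [MeasurableSMul₂ G X] [MulAction.IsPretransitive G X]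
  {μ : Measure G} [SFinite μ] [μ.IsMulLeftInvariant] [NeZero μ] {α : Measure X} [SFinite α]

/-- A set is null for a quasi-invariant measure on a transitive space if and only if its preimage
under an orbit map is null. -/
theorem IsQuasiInvariant.measure_eq_zero_iff (hα : α ≠ 0) (hαG : IsQuasiInvariant G α) (x₀ : X)
    {A : Set X} (hA : MeasurableSet A) :
    μ ((fun g : G => g • x₀) ⁻¹' A) = 0 ↔ α A = 0 := by
  have hmeas : MeasurableSet {p : G × X | p.1 • p.2 ∉ A} := measurable_smul hA.compl
  have hNZ : NeZero α := ⟨hα⟩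
  have hcomm := Measure.ae_ae_comm (μ := μ) (ν := α) (p := fun g x => g • x ∉ A) hmeas
  constructor
  · intro h
    have h₁ : ∀ᵐ x ∂α, ∀ᵐ g ∂μ, g • x ∉ A := by
      refine .of_forall fun x => ?_
      -- Changing the base point is a right translation of `G`, which preserves null sets.
      obtain ⟨k, rfl⟩ := MulAction.exists_smul_eq G x₀ x
      have h₂ : ∀ᵐ g ∂μ, g • x₀ ∉ A := measure_eq_zero_iff_ae_notMem.1 h
      filter_upwards [(quasiMeasurePreserving_mul_right μ k).ae h₂] with g hg
      rwa [← mul_smul]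
    obtain ⟨g, hg⟩ := (hcomm.2 h₁).exists
    refine measure_eq_zero_iff_ae_notMem.2 ?_
    filter_upwards [(hαG g⁻¹).ae hg] with x hx
    rwa [smul_inv_smul] at hx
  · intro h
    have h₁ : ∀ᵐ g ∂μ, ∀ᵐ x ∂α, g • x ∉ A :=
      .of_forall fun g => (hαG g).ae (measure_eq_zero_iff_ae_notMem.1 h)
    obtain ⟨x, hx⟩ := (hcomm.1 h₁).exists
    obtain ⟨k, hk⟩ := MulAction.exists_smul_eq G x x₀
    refine measure_eq_zero_iff_ae_notMem.2 ?_
    filter_upwards [(quasiMeasurePreserving_mul_right μ k).ae hx] with g hg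
    rwa [mul_smul, hk] at hg

theorem IsQuasiInvariant.quasiMeasurePreserving_smul (hα : α ≠ 0) (hαG : IsQuasiInvariant G α)
    (x₀ : X) : Measure.QuasiMeasurePreserving (fun g : G => g • x₀) μ α := by
  have hm : Measurable fun g : G => g • x₀ := by fun_prop
  refine ⟨hm, Measure.AbsolutelyContinuous.mk fun A hA h => ?_⟩
  rw [Measure.map_apply hm hA]
  exact (hαG.measure_eq_zero_iff hα x₀ hA).2 h

/-- Almost everywhere statements on `G × X` can be checked on `G × G`. -/
theorem IsQuasiInvariant.ae_prod_of_ae_prod_smul (hα : α ≠ 0) (hαG : IsQuasiInvariant G α)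
    (x₀ : X) {q : G × X → Prop} (hq : MeasurableSet {p | q p})
    (h : ∀ᵐ p : G × G ∂(μ.prod μ), q (p.1, p.2 • x₀)) : ∀ᵐ p ∂(μ.prod α), q p := by
  rw [Measure.ae_prod_iff_ae_ae hq]
  filter_upwards [Measure.ae_ae_of_ae_prod h] with g hg
  have hqg : MeasurableSet {x | ¬ q (g, x)} := (measurable_prodMk_left hq).compl
  exact (hαG.measure_eq_zero_iff hα x₀ hqg).1 hg

end MeasureClass

/-- Collapses three of the four factors of the multiplier identity into one. -/
theorem inv_mul_mul_inv_eq_of_mul_eq_mul {C : Type*} [CommGroup C] {a b c d : C}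
    (h : a * b = c * d) : a⁻¹ * (c * b⁻¹) = d⁻¹ := by
  rw [inv_mul_eq_iff_eq_mul, mul_inv_eq_iff_eq_mul, mul_right_comm, h, mul_inv_cancel_right]

/-! ### Almost everywhere coboundaries and their correction -/

section Scalars

variable {G X M : Type*} [Group G] [MeasurableSpace G] [MeasurableMul₂ G] [MeasurableInv G]
  {μ : Measure G} [SFinite μ] [μ.IsMulLeftInvariant] [NeZero μ]
  [MeasurableSpace X] [MulAction G X] [MeasurableSMul₂ G X]
  [Group M] [MulAction Circle M] [IsScalarTower Circle M M] [SMulCommClass Circle M M]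
  {m : G → G → Circle} {H : Subgroup G} {F : G → G → M} {b : G → M}

/-- The function `φ` is a projective homomorphism on `H`. -/
theorem IsMultiplier.map_mul_of_ae_eq_smul_mul (hm : IsMultiplier m) {φ : G → M}
    (hφ : ∀ h ∈ H, ∀ᵐ k ∂μ, b (k * h) = m k h • (b k * φ h)) {h₁ h₂ : G} (hh₁ : h₁ ∈ H)
    (hh₂ : h₂ ∈ H) : φ (h₁ * h₂) = m h₁ h₂ • (φ h₁ * φ h₂) := by
  -- One generic `k` suffices: expand `b (k * h₁ * h₂)` in two ways and cancel `b k`.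
  obtain ⟨k, hk₁, hk₂, hk₃⟩ := ((hφ h₁ hh₁).and (((quasiMeasurePreserving_mul_right μ h₁).ae
    (hφ h₂ hh₂)).and (hφ (h₁ * h₂) (mul_mem hh₁ hh₂)))).exists
  rw [hk₁, mul_assoc, hk₃] at hk₂
  have hs := hm.assoc k h₁ h₂
  rw [smul_mul_assoc, smul_smul, hs, mul_smul, smul_left_cancel_iff, mul_assoc,
    ← mul_smul_comm, mul_left_cancel_iff] at hk₂
  exact hk₂

variable [MeasurableSpace M] [MeasurableSMul₂ Circle M]

/-- A cocycle of `G` acting on itself is almost everywhere a coboundary. -/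
theorem IsMultiplier.exists_ae_eq_coboundary (hm : IsMultiplier m)
    (hF : Measurable fun p : G × G => F p.1 p.2)
    (hmul : ∀ᵐ p : G × G × G ∂(μ.prod (μ.prod μ)),
      F (p.1 * p.2.1) p.2.2 = m p.1 p.2.1 • (F p.1 (p.2.1 * p.2.2) * F p.2.1 p.2.2)) :
    ∃ b : G → M, Measurable b ∧ ∀ᵐ p : G × G ∂(μ.prod μ),
      F p.1 p.2 = (m p.1 p.2)⁻¹ • (b (p.1 * p.2) * (b p.2)⁻¹) := by
  have h₁ := Measure.ae_ae_of_ae_prod <|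
    (Measure.measurePreserving_swap.quasiMeasurePreserving.ae <|
      (measurePreserving_prodAssoc μ μ μ).quasiMeasurePreserving.ae hmul)
  obtain ⟨k₀, hk₀⟩ := h₁.exists
  have hq : Measure.QuasiMeasurePreserving (Prod.map id fun k : G => k * k₀⁻¹)
      (μ.prod μ) (μ.prod μ) :=
    QuasiMeasurePreserving.prodMap (.id μ) (quasiMeasurePreserving_mul_right μ k₀⁻¹)
  have hmm := hm.measurable
  -- Read off from the cocycle identity at `(g, k * k₀⁻¹, k₀)`; the factor `m (k * k₀⁻¹) k₀` leaves
  -- only `m g k`.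
  refine ⟨fun k => m (k * k₀⁻¹) k₀ • F (k * k₀⁻¹) k₀, ?_, ?_⟩
  · refine Measurable.smul ?_ ?_
    · exact hmm.comp (f := fun k => (k * k₀⁻¹, k₀)) (by fun_prop)
    · exact hF.comp (f := fun k => (k * k₀⁻¹, k₀)) (by fun_prop)
  · filter_upwards [hq.ae hk₀] with ⟨g, k⟩ h
    have h' : F (g * (k * k₀⁻¹)) k₀ =
        m g (k * k₀⁻¹) • (F g k * F (k * k₀⁻¹) k₀) := by
      simpa [MeasurableEquiv.prodAssoc] using h
    have ha := hm.assoc g (k * k₀⁻¹) k₀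
    rw [inv_mul_cancel_right] at ha
    dsimp only
    rw [mul_assoc g k, h', smul_inv]
    simp only [smul_mul_assoc, mul_smul_comm, smul_smul, mul_inv_cancel_right]
    rw [ha, mul_comm (m g k)]
    simp

variable [StandardBorelSpace M] [MeasurableMul₂ M] [MeasurableInv M]

/-- If `F` is right invariant under `H`, then `b` is almost everywhere equivariant under `H`. -/
theorem IsMultiplier.exists_ae_eq_smul_mul (hm : IsMultiplier m) (hb : Measurable b)
    (hFH : ∀ g k, ∀ h ∈ H, F g (k * h) = F g k)
    (hFb : ∀ᵐ p : G × G ∂(μ.prod μ), F p.1 p.2 = (m p.1 p.2)⁻¹ • (b (p.1 * p.2) * (b p.2)⁻¹)) :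
    ∃ φ : G → M, Measurable φ ∧ ∀ h ∈ H, ∀ᵐ k ∂μ, b (k * h) = m k h • (b k * φ h) := by
  have hmm := hm.measurable
  have hu : Measurable fun p : G × G => (m p.2 p.1)⁻¹ • ((b p.2)⁻¹ * b (p.2 * p.1)) := by
    have : Measurable fun p : G × G => m p.2 p.1 := hmm.comp measurable_swap
    fun_prop
  obtain ⟨φ, hφ, hφu⟩ := exists_measurable_ae_const_value μ
    (u := fun h k => (m k h)⁻¹ • ((b k)⁻¹ * b (k * h))) hu
  refine ⟨φ, hφ, fun h hh => ?_⟩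
  obtain ⟨a, ha⟩ := exists_ae_eq_const_of_ae_mul_left_eq (μ := μ)
      (u := fun k => (m k h)⁻¹ • ((b k)⁻¹ * b (k * h))) <| by
    have hq : Measure.QuasiMeasurePreserving (Prod.map id fun k : G => k * h)
        (μ.prod μ) (μ.prod μ) :=
      QuasiMeasurePreserving.prodMap (.id μ) (quasiMeasurePreserving_mul_right μ h)
    filter_upwards [hFb, hq.ae hFb] with ⟨g, k⟩ h₁ h₂
    simp only [Prod.map_apply, id] at h₁ h₂
    rw [hFH g k h hh, h₁, ← mul_assoc] at h₂
    have hs := hm.assoc g k h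
    have hb' : b (g * k * h) = (m g (k * h) * (m g k)⁻¹) • (b (g * k) * (b k)⁻¹ * b (k * h)) := by
      rw [mul_smul, ← smul_mul_assoc, h₂, smul_mul_assoc, smul_inv_smul, inv_mul_cancel_right]
    have hs' : (m (g * k) h)⁻¹ * (m g (k * h) * (m g k)⁻¹) = (m k h)⁻¹ :=
      inv_mul_mul_inv_eq_of_mul_eq_mul hs
    dsimp only
    rw [hb']
    simp only [mul_smul_comm, smul_smul, hs', mul_assoc, inv_mul_cancel_left]
  filter_upwards [ha] with k hk
  rw [hφu h a ha, ← hk, mul_smul_comm, smul_smul]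
  simp

/-- The almost everywhere coboundary `b` can be corrected on a null set so as to be equivariant
everywhere. -/
theorem IsMultiplier.exists_equivariant_ae_eq (hm : IsMultiplier m) {x₀ : X} {c : X → G}
    (hc : Measurable c) (hcx : ∀ x, c x • x₀ = x) (hF : Measurable fun p : G × G => F p.1 p.2)
    (hb : Measurable b) (hFH : ∀ g k, ∀ h ∈ MulAction.stabilizer G x₀, F g (k * h) = F g k)
    (hFb : ∀ᵐ p : G × G ∂(μ.prod μ), F p.1 p.2 = (m p.1 p.2)⁻¹ • (b (p.1 * p.2) * (b p.2)⁻¹)) :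
    ∃ b' φ : G → M, Measurable b' ∧ (∀ᵐ k ∂μ, b' k = b k) ∧
      ∀ k, ∀ h ∈ MulAction.stabilizer G x₀, b' (k * h) = m k h • (b' k * φ h) := by
  obtain ⟨φ, hφ, hφb⟩ := hm.exists_ae_eq_smul_mul hb hFH hFb
  have hmm := hm.measurable
  have hu : Measurable fun p : X × G =>
      (m p.2 (c p.1))⁻¹ • ((F p.2 (c p.1))⁻¹ * b (p.2 * c p.1)) := by
    have h₁ : Measurable fun p : X × G => m p.2 (c p.1) :=
      hmm.comp (f := fun p : X × G => (p.2, c p.1)) (by fun_prop)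
    have h₂ : Measurable fun p : X × G => F p.2 (c p.1) :=
      hF.comp (f := fun p : X × G => (p.2, c p.1)) (by fun_prop)
    fun_prop
  -- `β x` is the corrected value at `c x`. The range of `c` may be null, so it is recovered from
  -- generic translates `b (g * c x)`.
  obtain ⟨β, hβ, hβu⟩ := exists_measurable_ae_const_value μ
    (u := fun x g => (m g (c x))⁻¹ • ((F g (c x))⁻¹ * b (g * c x))) hu
  let t : G → G := fun k => (c (k • x₀))⁻¹ * k
  have htm : Measurable t := by fun_prop
  have hct : ∀ k, c (k • x₀) * t k = k := fun k => mul_inv_cancel_left _ _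
  have ht : ∀ k, t k ∈ MulAction.stabilizer G x₀ := fun k => by
    rw [MulAction.mem_stabilizer_iff, mul_smul, inv_smul_eq_iff, hcx]
  -- Forced by equivariance along `k = c (k • x₀) * t k`.
  refine ⟨fun k => m (c (k • x₀)) (t k) • (β (k • x₀) * φ (t k)), φ, ?_, ?_, fun k h hh => ?_⟩
  · have : Measurable fun k => m (c (k • x₀)) (t k) :=
      hmm.comp (f := fun k => (c (k • x₀), t k)) (by fun_prop)
    fun_prop
  · have hFb' := Measure.ae_ae_of_ae_prod
      (Measure.measurePreserving_swap.quasiMeasurePreserving.ae hFb)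
    filter_upwards [hFb'] with k hk
    simp only [Prod.swap_prod_mk] at hk
    have hβk : β (k • x₀) = (m (c (k • x₀)) (t k))⁻¹ • (b k * (φ (t k))⁻¹) := by
      refine hβu _ _ ?_
      filter_upwards [hk, (quasiMeasurePreserving_mul_right μ (c (k • x₀))).ae (hφb _ (ht k))]
        with g h₁ h₂
      have hs := hm.assoc g (c (k • x₀)) (t k)
      have hF' := hFH g (c (k • x₀)) (t k) (ht k)
      rw [hct] at hF' hs
      rw [mul_assoc, hct] at h₂
      rw [← hF', h₁, h₂]
      rw [← inv_mul_mul_inv_eq_of_mul_eq_mul hs, smul_mul_assoc, smul_smul, smul_inv, smul_mul_assoc,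
        smul_smul]
      congr 1
      · rw [mul_inv_rev, inv_inv, mul_left_comm, mul_comm (m g (c (k • x₀)))⁻¹,
          mul_left_comm]
      · group
    simp [hβk, smul_mul_assoc]
  · have hk : (k * h) • x₀ = k • x₀ := by rw [mul_smul, MulAction.mem_stabilizer_iff.1 hh]
    have htk : t (k * h) = t k * h := by simp only [t, hk, mul_assoc]
    dsimp only
    rw [hk, htk, hm.map_mul_of_ae_eq_smul_mul hφb (ht k) hh]
    have hs := hm.assoc (c (k • x₀)) (t k) h
    rw [hct] at hs
    simp only [smul_mul_assoc, mul_smul_comm, smul_smul, mul_assoc]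
    rw [hs]

end Scalars

/-! ### Strict cocycles and strict cohomology -/

section Strict

variable {G X M : Type*} [Group G] [MeasurableSpace G] [MeasurableMul₂ G]
  [MeasurableSpace X] [MulAction G X]
  [Group M] [MulAction Circle M] [IsScalarTower Circle M M] [SMulCommClass Circle M M]
  [MeasurableSpace M] [MeasurableMul₂ M] [MeasurableInv M]
  {m : G → G → Circle} {x₀ : X} {c : X → G}

/-- An equivariant map `b : G → M` induces a strict cocycle. -/
theorem IsMultiplier.exists_strict_of_equivariant [MeasurableSMul₂ Circle M]
    (hm : IsMultiplier m) (hc : Measurable c) (hcx : ∀ x, c x • x₀ = x) {b φ : G → M} (hb : Measurable b)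
    (hbφ : ∀ k, ∀ h ∈ MulAction.stabilizer G x₀, b (k * h) = m k h • (b k * φ h)) :
    ∃ f : G × X → M, Measurable f ∧ (∀ x, f (1, x) = 1) ∧
      (∀ g₁ g₂ x, f (g₁ * g₂, x) = m g₁ g₂ • (f (g₁, g₂ • x) * f (g₂, x))) ∧
      ∀ g k, f (g, k • x₀) = (m g k)⁻¹ • (b (g * k) * (b k)⁻¹) := by
  -- The `φ t` factors cancel, so the coboundary depends on `s` only through `s • x₀`.
  have shift : ∀ g s, ∀ t ∈ MulAction.stabilizer G x₀,
      (m g s)⁻¹ • (b (g * s) * (b s)⁻¹) =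
        (m g (s * t))⁻¹ • (b (g * (s * t)) * (b (s * t))⁻¹) := by
    intro g s t ht
    rw [← inv_mul_mul_inv_eq_of_mul_eq_mul (hm.assoc g s t).symm, ← mul_assoc g s t,
      hbφ _ t ht, hbφ _ t ht, smul_inv, mul_inv_rev, smul_mul_smul_comm, smul_smul]
    congr 1
    group
  have key : ∀ g k, (m g (c (k • x₀)))⁻¹ • (b (g * c (k • x₀)) * (b (c (k • x₀)))⁻¹) =
      (m g k)⁻¹ • (b (g * k) * (b k)⁻¹) := by
    intro g k
    have := shift g (c (k • x₀)) ((c (k • x₀))⁻¹ * k) <| by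
      rw [MulAction.mem_stabilizer_iff, mul_smul, inv_smul_eq_iff, hcx]
    rwa [mul_inv_cancel_left] at this
  refine ⟨fun p => (m p.1 (c p.2))⁻¹ • (b (p.1 * c p.2) * (b (c p.2))⁻¹), ?_, fun x => ?_,
    fun g₁ g₂ x => ?_, key⟩
  · have : Measurable fun p : G × X => m p.1 (c p.2) :=
      hm.measurable.comp (f := fun p : G × X => (p.1, c p.2)) (by fun_prop)
    exact this.inv.smul (by fun_prop)
  · simp [hm.one_left]
  · have hx : g₂ • x = (g₂ * c x) • x₀ := by rw [mul_smul, hcx]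
    have hs := hm.assoc g₁ g₂ (c x)
    dsimp only
    rw [hx, key]
    simp only [smul_mul_assoc, mul_smul_comm, smul_smul, mul_assoc, inv_mul_cancel_left]
    congr 1
    rw [eq_comm, ← inv_eq_iff_eq_inv, mul_inv_rev, mul_inv_rev, inv_inv, inv_inv, ← hs,
      mul_inv_cancel_right]

variable [MeasurableInv G] {μ : Measure G} [SFinite μ] [μ.IsMulLeftInvariant] [NeZero μ]

/-- Strict cocycles that agree almost everywhere are strictly cohomologous. -/
theorem strictlyCohomologous_of_ae_eq (hc : Measurable c)
    (hcx : ∀ x, c x • x₀ = x) {f₁ f₂ : G × X → M} (hf₁ : Measurable f₁) (hf₂ : Measurable f₂)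
    (hmul₁ : ∀ g₁ g₂ x, f₁ (g₁ * g₂, x) = m g₁ g₂ • (f₁ (g₁, g₂ • x) * f₁ (g₂, x)))
    (hmul₂ : ∀ g₁ g₂ x, f₂ (g₁ * g₂, x) = m g₁ g₂ • (f₂ (g₁, g₂ • x) * f₂ (g₂, x)))
    (h : ∀ᵐ p : G × G ∂(μ.prod μ), f₁ (p.1, p.2 • x₀) = f₂ (p.1, p.2 • x₀)) :
    StrictlyCohomologous f₁ f₂ := by
  obtain ⟨a, ha⟩ := exists_ae_eq_const_of_ae_mul_left_eq (μ := μ)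
      (u := fun k => (f₂ (k, x₀))⁻¹ * f₁ (k, x₀)) <| by
    filter_upwards [h] with ⟨g, k⟩ hgk
    dsimp only at hgk ⊢
    rw [hmul₁, hmul₂, hgk]
    simp [smul_inv, smul_mul_assoc, mul_smul_comm, mul_assoc]
  have ha' : ∀ᵐ k ∂μ, f₁ (k, x₀) = f₂ (k, x₀) * a := by
    filter_upwards [ha] with k hk
    rw [← hk, mul_inv_cancel_left]
  have hφ : ∀ t ∈ MulAction.stabilizer G x₀, a * f₁ (t, x₀) = f₂ (t, x₀) * a := by
    intro t ht
    rw [MulAction.mem_stabilizer_iff] at ht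
    obtain ⟨k, hk₁, hk₂⟩ := (ha'.and ((quasiMeasurePreserving_mul_right μ t).ae ha')).exists
    rw [hmul₁, hmul₂, ht, hk₁, smul_mul_assoc, smul_left_cancel_iff, mul_assoc, mul_assoc,
      mul_left_cancel_iff] at hk₂
    exact hk₂
  have hB : ∀ k, ∀ t ∈ MulAction.stabilizer G x₀,
      f₂ (k * t, x₀) * a * (f₁ (k * t, x₀))⁻¹ = f₂ (k, x₀) * a * (f₁ (k, x₀))⁻¹ := by
    intro k t ht
    have := hφ t ht
    rw [MulAction.mem_stabilizer_iff] at ht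
    rw [hmul₁, hmul₂, ht, smul_inv, smul_mul_assoc, mul_assoc (f₂ (k, x₀)), ← this]
    simp only [smul_mul_assoc, mul_smul_comm, smul_smul, inv_mul_cancel, one_smul]
    group
  -- By `hB` the value is the same for any group element carrying `x₀` to `x`.
  refine ⟨fun x => f₂ (c x, x₀) * a * (f₁ (c x, x₀))⁻¹, ?_, fun g x => ?_⟩
  · have h₁ : Measurable fun x => f₁ (c x, x₀) := hf₁.comp (hc.prodMk measurable_const)
    have h₂ : Measurable fun x => f₂ (c x, x₀) := hf₂.comp (hc.prodMk measurable_const)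
    fun_prop
  · have hB' := hB (g * c x) ((g * c x)⁻¹ * c (g • x)) <| by
      rw [MulAction.mem_stabilizer_iff, mul_smul, hcx, inv_smul_eq_iff, mul_smul, hcx]
    rw [mul_inv_cancel_left] at hB'
    dsimp only
    rw [hB', hmul₁, hmul₂, hcx, smul_inv]
    simp only [smul_mul_assoc, mul_smul_comm, smul_smul, inv_mul_cancel, one_smul]
    group

end Strict

/-! ### Assembly -/

theorem mainTheorem7 {G X M : Type*}
    -- `G` is a locally compact second countable Hausdorff group with its Borel structure
    [Group G] [TopologicalSpace G] [IsTopologicalGroup G] [LocallyCompactSpace G]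
    [SecondCountableTopology G] [T2Space G] [MeasurableSpace G] [BorelSpace G]
    -- `X` is a transitive standard Borel `G`-space
    [MeasurableSpace X] [StandardBorelSpace X] [MulAction G X] [MeasurableSMul₂ G X]
    [MulAction.IsPretransitive G X]
    -- `M` is a standard Borel group
    [Group M] [MeasurableSpace M] [StandardBorelSpace M] [MeasurableMul₂ M] [MeasurableInv M]
    -- in which the circle group acts by central elements
    (ι : Circle →* M) (hι : Measurable ι) (hιc : ∀ z : Circle, ι z ∈ Subgroup.center M)
    (m : G → G → Circle) (hm : IsMultiplier m)
    -- a Haar measure on `G`, and a measure in the invariant measure class on `X`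
    (μ : Measure G) [μ.IsHaarMeasure]
    (α : Measure X) [SigmaFinite α] (hα : α ≠ 0) (hαG : IsQuasiInvariant G α)
    (f : G × X → M) (hf : IsCocycle ι m μ α f) :
    (∃ f₁ : G × X → M, IsStrictCocycle ι m f₁ ∧ ∀ᵐ p ∂(μ.prod α), f p = f₁ p) ∧
    (∀ f₁ f₂ : G × X → M,
      IsStrictCocycle ι m f₁ → (∀ᵐ p ∂(μ.prod α), f p = f₁ p) →
      IsStrictCocycle ι m f₂ → (∀ᵐ p ∂(μ.prod α), f p = f₂ p) →
      StrictlyCohomologous f₁ f₂) := by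
  let _ : MulAction Circle M := MulAction.compHom M ι
  have hsmul : ∀ (z : Circle) (y : M), z • y = ι z * y := fun _ _ => rfl
  have : IsScalarTower Circle M M := ⟨fun z x y => mul_assoc (ι z) x y⟩
  have : SMulCommClass Circle M M := ⟨fun z x y => by
    simp only [hsmul, smul_eq_mul]
    rw [← mul_assoc, ← mul_assoc, Subgroup.mem_center_iff.1 (hιc z) x]⟩
  have : MeasurableSMul₂ Circle M := ⟨by
    simp only [hsmul]
    exact (hι.comp measurable_fst).mul measurable_snd⟩
  have hstrict : ∀ {f' : G × X → M}, IsStrictCocycle ι m f' → ∀ g₁ g₂ x,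
      f' (g₁ * g₂, x) = m g₁ g₂ • (f' (g₁, g₂ • x) * f' (g₂, x)) := fun h g₁ g₂ x => by
    rw [h.map_mul, hsmul, mul_assoc]
  obtain ⟨x₀⟩ : Nonempty X := by
    by_contra hX
    rw [not_nonempty_iff] at hX
    exact hα (Measure.eq_zero_of_isEmpty α)
  obtain ⟨c, hc, hcx⟩ := exists_measurable_section_of_isPretransitive (G := G) x₀
  have hq := hαG.quasiMeasurePreserving_smul (μ := μ) hα x₀
  have hq₂ : Measure.QuasiMeasurePreserving (Prod.map id fun g : G => g • x₀)
    (μ.prod μ) (μ.prod α) := QuasiMeasurePreserving.prodMap (.id μ) hq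
  refine ⟨?_, fun f₁ f₂ hs₁ h₁ hs₂ h₂ => ?_⟩
  · have hq₃ : Measure.QuasiMeasurePreserving (Prod.map id (Prod.map id fun g : G => g • x₀))
      (μ.prod (μ.prod μ)) (μ.prod (μ.prod α)) := QuasiMeasurePreserving.prodMap (.id μ) hq₂
    have hF : Measurable fun p : G × G => f (p.1, p.2 • x₀) :=
      hf.measurable.comp (f := fun p : G × G => (p.1, p.2 • x₀)) (by fun_prop)
    obtain ⟨b, hb, hbF⟩ := hm.exists_ae_eq_coboundary (μ := μ)
        (F := fun g k => f (g, k • x₀)) hF <| by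
      filter_upwards [hq₃.ae hf.map_mul] with p hp
      simpa [hsmul, mul_assoc, mul_smul] using hp
    obtain ⟨b', φ, hb', hbb', hbφ⟩ := hm.exists_equivariant_ae_eq (μ := μ)
      (F := fun g k => f (g, k • x₀)) hc hcx hF hb
      (fun g k h hh => by rw [mul_smul, MulAction.mem_stabilizer_iff.1 hh]) hbF
    obtain ⟨f₁, hf₁, hone, hmul, hval⟩ := hm.exists_strict_of_equivariant hc hcx hb' hbφ
    refine ⟨f₁, ⟨hf₁, hone, fun g₁ g₂ x => by rw [hmul, hsmul, mul_assoc]⟩, ?_⟩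
    refine hαG.ae_prod_of_ae_prod_smul hα x₀ (measurableSet_eq_fun hf.measurable hf₁) ?_
    filter_upwards [hbF, (quasiMeasurePreserving_mul μ μ).ae hbb', Measure.quasiMeasurePreserving_snd.ae hbb']
      with p hp h₁ h₂
    rw [hp, hval, h₁, h₂]
  · refine strictlyCohomologous_of_ae_eq (μ := μ) hc hcx hs₁.measurable hs₂.measurable
      (hstrict hs₁) (hstrict hs₂) ?_
    filter_upwards [hq₂.ae h₁, hq₂.ae h₂] with p hp₁ hp₂
    exact hp₁.symm.trans hp₂
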